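/- Let $G$ be a finite simple graph of order $n$ and let $k$ be an integer with $1\le k\le n-1$. The $k$-token graph $F_k(G)$ is the graph whose vertices are the $k$-element subsets of $V(G)$, two of them being adjacent when their symmetric difference is a pair of adjacent vertices of $G$. For a finite graph $H$ with at least two vertices let $\delta(H)$ be its minimum degree, let the connectivity $\kappa(H)$ be the greatest integer $t<|V(H)|$ such that $H$ remains connected after the deletion of any set of fewer than $t$ vertices, and let the edge-connectivity $\lambda(H)$ be the greatest integer $t$ such that $H$ remains connected after the deletion of any set of fewer than $t$ edges. **Theorem.** If $G$ is a tree of order $n$ and $1\le k\le n-1$, then $$\kappa(F_k(G))=\lambda(F_k(G))=\delta(F_k(G)).$$ -/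

import Mathlib

namespace SimpleGraph

/-- The `k`-token graph of `G`: its vertices are the `k`-subsets of `V`, and two of them are adjacent
when their symmetric difference is a pair of adjacent vertices of `G`. -/
def tokenGraph {V : Type*} [DecidableEq V] (G : SimpleGraph V) (k : ℕ) :
    SimpleGraph {A : Finset V // A.card = k} where
  Adj A B := ∃ a b : V, G.Adj a b ∧ symmDiff A.1 B.1 = {a, b}
  symm := ⟨fun A B ⟨a, b, hab, h⟩ => ⟨a, b, hab, by rw [symmDiff_comm]; exact h⟩⟩
  loopless := ⟨fun A ⟨a, b, _, h⟩ => by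
    rw [symmDiff_self] at h
    exact Finset.insert_ne_empty a {b} h.symm⟩

/-- A finite graph is `t`-connected if it has more than `t` vertices and deleting any set of fewer
than `t` vertices leaves a connected graph. -/
def IsVertexConnected {V : Type*} [Fintype V] (G : SimpleGraph V) (t : ℕ) : Prop :=
  t < Fintype.card V ∧ ∀ S : Finset V, S.card < t → (G.induce {v : V | v ∉ S}).Connected

/-- The (vertex-)connectivity `κ(G)`: the greatest `t` such that `G` is `t`-connected. In particular
`κ(G) = 0` if `G` is disconnected, and the complete graph on `m ≥ 1` vertices has `κ = m - 1`. -/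
noncomputable def vertexConnectivity {V : Type*} [Fintype V] (G : SimpleGraph V) : ℕ :=
  sSup {t : ℕ | G.IsVertexConnected t}

/-- The edge-connectivity `λ(G)`: the greatest `t` such that `G` is `t`-edge-connected, that is,
stays connected after the deletion of any set of fewer than `t` edges. For a graph with at most one
vertex every `t` qualifies, and the supremum takes the conventional value `0`. -/
noncomputable def edgeConnectivity {V : Type*} [Fintype V] (G : SimpleGraph V) : ℕ :=
  sSup {t : ℕ | G.IsEdgeConnected t}

end SimpleGraph

namespace SimpleGraph

/-! ### Token moves, and exits from families of token sets. -/

section TokenMoves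

/-! Since `κ ≤ λ ≤ δ` (Whitney), it suffices that deleting a set `S` of fewer than `δ` vertices
leaves the token graph connected. Any two components of the remainder are families of `k`-sets left
only through `S`, and `IsTree.inter_nonempty_of_moveClosed` shows that such families meet.

That lemma is an induction deleting a leaf `l`. Either `S` has so few members avoiding `l` that
induction applies to the `k`-sets of `G - l`, the bound dropping by at most one, or every member of
`S` avoids `l` and the `k`-sets containing `l` are unobstructed. Both families must reach the chosen
slice: by `IsTree.le_card_of_moveClosed_of_notMem` and its complementary form, a family whose
members all avoid (or all contain) a vertex has at least `d` exits. There the moves available at one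
well-chosen `A` are mapped injectively to exits; absence of triangles gives injectivity. -/

lemma Preconnected.exists_adj_mem_notMem {V : Type*} {H : SimpleGraph V} (hH : H.Preconnected)
    {X : Set V} {u v : V} (hu : u ∈ X) (hv : v ∉ X) : ∃ a ∈ X, ∃ b ∉ X, H.Adj a b := by
  obtain ⟨p⟩ := hH u v
  obtain ⟨d, -, h1, h2⟩ := p.exists_boundary_dart X hu hv
  exact ⟨d.fst, h1, d.snd, h2, d.adj⟩

section

variable {V : Type*} {G : SimpleGraph V}

/-- A vertex of a tree has at most one neighbour that is no further away from a given root. -/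
lemma IsTree.eq_of_adj_of_dist_le (hG : G.IsTree) {t z b c : V} (hb : G.Adj b z) (hc : G.Adj c z)
    (hbz : G.dist t b ≤ G.dist t z) (hcz : G.dist t c ≤ G.dist t z) : b = c := by
  have key : ∀ y, G.Adj y z → G.dist t y ≤ G.dist t z →
      ∃ p : G.Walk t z, p.IsPath ∧ p.penultimate = y := by
    classical
    intro y hy hyz
    obtain ⟨p, hp, hl⟩ := hG.connected.exists_path_of_dist t y
    refine ⟨p.concat hy, hp.concat ?_ hy, by simp⟩
    -- If `z` lay on a shortest path to `y ≠ z`, it would be strictly closer to `t` than `y`.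
    intro hz
    have h1 := G.dist_le (p.takeUntil z hz)
    have h2 := congrArg Walk.length (p.take_spec hz)
    rw [Walk.length_append] at h2
    have h3 : (p.dropUntil z hz).length ≠ 0 := fun h0 => hy.ne (Walk.eq_of_length_eq_zero h0).symm
    omega
  obtain ⟨p, hp, rfl⟩ := key b hb hbz
  obtain ⟨q, hq, rfl⟩ := key c hc hcz
  have := (hG.isAcyclic.subsingleton_path t z).elim ⟨p, hp⟩ ⟨q, hq⟩
  simp only [Subtype.mk.injEq] at this
  rw [this]

lemma IsTree.not_triangle (hG : G.IsTree) {a b c : V} (hab : G.Adj a b) (hac : G.Adj a c)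
    (hbc : G.Adj b c) : False :=
  hbc.ne (hG.eq_of_adj_of_dist_le (t := b) (z := a) hab.symm hac.symm (by simp)
    (by rw [dist_eq_one_iff_adj.2 hbc, dist_eq_one_iff_adj.2 hab.symm]))

end

variable {V : Type*} [DecidableEq V] (G : SimpleGraph V)

/-- `B` arises from `A` by moving one token along an edge of `G`. -/
def TokenMove (A B : Finset V) : Prop :=
  ∃ a ∈ A, ∃ b ∉ A, G.Adj a b ∧ B = insert b (A.erase a)

/-- Every token move starting in the family `C` ends in `C ∪ S`. -/
def MoveClosed (S : Finset (Finset V)) (C : Set (Finset V)) : Prop :=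
  ∀ A ∈ C, ∀ B, G.TokenMove A B → B ∈ C ∨ B ∈ S

variable {G}

/-- The possible first exits from a move-closed family, starting with the move `e` at `A`, when the
move of the token at `t` to `v` leaves the family. -/
def ExitOf (A : Finset V) (t v x : V) (e : V × V) (B : Finset V) : Prop :=
  (e.2 = v ∧ B = insert v (A.erase e.1)) ∨
  (e.2 ≠ v ∧ e.1 ≠ t ∧ (B = insert e.2 (A.erase e.1) ∨
    B = insert v ((insert e.2 (A.erase e.1)).erase t))) ∨
  (e.2 ≠ v ∧ e.1 = t ∧ (B = insert e.2 (A.erase t) ∨ B = insert e.2 (A.erase x) ∨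
    B = insert v ((insert e.2 (A.erase x)).erase t)))

lemma TokenMove.mk {A : Finset V} {a b : V} (ha : a ∈ A) (hb : b ∉ A) (h : G.Adj a b) :
    G.TokenMove A (insert b (A.erase a)) := ⟨a, ha, b, hb, h, rfl⟩

lemma card_insert_erase {A : Finset V} {a b : V} (ha : a ∈ A) (hb : b ∉ A) :
    (insert b (A.erase a)).card = A.card := by
  rw [Finset.card_insert_of_notMem (by simp [hb]), Finset.card_erase_add_one ha]

variable [Fintype V]

open Classical in
variable (G) in
/-- The pairs `(a, b)` such that the token at `a` can move to the free vertex `b`. -/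
noncomputable def tokenMoves (A : Finset V) : Finset (V × V) :=
  Finset.univ.filter fun e => e.1 ∈ A ∧ e.2 ∉ A ∧ G.Adj e.1 e.2

@[simp] lemma mem_tokenMoves {A : Finset V} {a b : V} :
    (a, b) ∈ G.tokenMoves A ↔ a ∈ A ∧ b ∉ A ∧ G.Adj a b := by
  simp [tokenMoves]

lemma TokenMove.compl {A B : Finset V} (h : G.TokenMove A B) : G.TokenMove Aᶜ Bᶜ := by
  obtain ⟨a, ha, b, hb, hab, rfl⟩ := h
  refine ⟨b, by simpa, a, by simpa, hab.symm, ?_⟩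
  ext y; by_cases y = a <;> by_cases y = b <;> grind [Finset.mem_compl]

lemma tokenMoves_compl_card (A : Finset V) :
    (G.tokenMoves Aᶜ).card = (G.tokenMoves A).card := by
  refine Finset.card_bij' (fun e _ => e.swap) (fun e _ => e.swap) ?_ ?_ ?_ ?_
  · rintro ⟨a, b⟩ h; simp at h ⊢; exact ⟨h.2.1, h.1, h.2.2.symm⟩
  · rintro ⟨a, b⟩ h; simp at h ⊢; exact ⟨h.2.1, h.1, h.2.2.symm⟩
  · simp
  · simp

/-- If a token at `t` sees only free vertices, it can be moved to a far away free vertex without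
increasing the number of moves that do not involve it by more than one. -/
lemma IsTree.exists_card_tokenMoves_le (hG : G.IsTree) {A : Finset V} {t v : V} (ht : t ∈ A)
    (hv : v ∉ A) (hX : ∀ x ∈ A, ¬ G.Adj t x) :
    ∃ A' : Finset V, A'.card = A.card ∧
      (G.tokenMoves A').card ≤ ((G.tokenMoves A).filter fun e => e.1 ≠ t).card + 1 := by
  obtain ⟨z, hz, hmax⟩ := Finset.exists_max_image Aᶜ (G.dist t) ⟨v, by simpa⟩
  simp only [Finset.mem_compl] at hz hmax
  refine ⟨insert z (A.erase t), card_insert_erase ht hz, ?_⟩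
  have hsplit := Finset.card_filter_add_card_filter_not (s := G.tokenMoves (insert z (A.erase t)))
    (fun e => e.1 = z)
  -- No free vertex is farther from `t` than `z`, so the only possible free neighbour of `z` is the
  -- next vertex towards `t`.
  have h1 : ((G.tokenMoves (insert z (A.erase t))).filter fun e => e.1 = z).card ≤ 1 := by
    rw [Finset.card_le_one]
    have hd : ∀ b, b ∉ insert z (A.erase t) → G.dist t b ≤ G.dist t z := by
      intro b hb
      by_cases hbt : b = t
      · simp [hbt]
      · exact hmax b (by grind)
    rintro ⟨a, b⟩ h ⟨a', b'⟩ h'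
    simp only [Finset.mem_filter, mem_tokenMoves] at h h'
    obtain ⟨⟨-, hb, hab⟩, rfl⟩ := h
    obtain ⟨⟨-, hb', hab'⟩, rfl⟩ := h'
    rw [hG.eq_of_adj_of_dist_le hab.symm hab'.symm (hd b hb) (hd b' hb')]
  have h2 : ((G.tokenMoves (insert z (A.erase t))).filter fun e => ¬ e.1 = z).card ≤
      ((G.tokenMoves A).filter fun e => e.1 ≠ t).card := by
    apply Finset.card_le_card
    rintro ⟨a, b⟩ h
    simp only [Finset.mem_filter, mem_tokenMoves, Finset.mem_insert, Finset.mem_erase] at h ⊢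
    -- The vacated `t` has no neighbour in `A`, so no other token can move there.
    have : b ≠ t := by
      rintro rfl
      exact hX a (by tauto) h.1.2.2.symm
    tauto
  omega

/-- The exit `B` reveals the target of the first move through its new vertex other than `v`, and the
source through the vertex missing from `A`. The only ambiguity is between moves to a common `b` from
`t` and from `x`; then `t`, `x`, `b` would form a triangle. -/
lemma ExitOf.eq (hG : G.IsTree) {A : Finset V} {t v x : V} {e e' : V × V} {B : Finset V}
    (ht : t ∈ A) (hv : v ∉ A) (he : e ∈ G.tokenMoves A) (he' : e' ∈ G.tokenMoves A)
    (hx : e.1 ≠ t → e'.1 = t → e'.2 ≠ v → G.Adj t x)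
    (hx' : e'.1 ≠ t → e.1 = t → e.2 ≠ v → G.Adj t x)
    (h : ExitOf A t v x e B) (h' : ExitOf A t v x e' B) : e = e' := by
  have hsnd : ∀ e ∈ G.tokenMoves A, ExitOf A t v x e B →
      ∀ y, y ∉ A → y ≠ v → (y ∈ B ↔ y = e.2) := by
    rintro ⟨a, b⟩ he h y hy hyv
    rw [mem_tokenMoves] at he
    obtain ⟨h1, rfl⟩ | ⟨h1, h2, rfl | rfl⟩ | ⟨h1, h2, rfl | rfl | rfl⟩ := h <;> grind
  have hfst : ∀ e ∈ G.tokenMoves A, ExitOf A t v x e B →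
      (e.2 = v → ∀ y ∈ A, (y ∉ B ↔ y = e.1)) ∧
      (e.2 ≠ v → e.1 ≠ t → ∀ y ∈ A, y ≠ t → (y ∉ B ↔ y = e.1)) ∧
      (e.2 ≠ v → e.1 = t → ∀ y ∈ A, y ≠ t → y ∉ B → y = x) := by
    rintro ⟨a, b⟩ he h
    rw [mem_tokenMoves] at he
    obtain ⟨h1, rfl⟩ | ⟨h1, h2, rfl | rfl⟩ | ⟨h1, h2, rfl | rfl | rfl⟩ := h <;> grind
  have s := hsnd e he h
  have s' := hsnd e' he' h'
  have f := hfst e he h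
  have f' := hfst e' he' h'
  obtain ⟨a, b⟩ := e
  obtain ⟨a', b'⟩ := e'
  rw [mem_tokenMoves] at he he'
  have hb : b = b' := by
    by_cases hbv : b = v
    · by_cases hbv' : b' = v
      · rw [hbv, hbv']
      · exact ((s b' he'.2.1 hbv').1 ((s' b' he'.2.1 hbv').2 rfl)).symm
    · exact (s' b he.2.1 hbv).1 ((s b he.2.1 hbv).2 rfl)
  subst hb
  have ha : a = a' := by
    by_cases hbv : b = v
    · exact (f'.1 hbv a he.1).1 ((f.1 hbv a he.1).2 rfl)
    by_cases hat : a = t <;> by_cases hat' : a' = t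
    · rw [hat, hat']
    · exfalso
      have := f.2.2 hbv hat a' he'.1 hat' ((f'.2.1 hbv hat' a' he'.1 hat').2 rfl)
      have hxx := hx' hat' hat hbv
      subst this hat
      exact hG.not_triangle hxx he.2.2 he'.2.2
    · exfalso
      have := f'.2.2 hbv hat' a he.1 hat ((f.2.1 hbv hat a he.1 hat).2 rfl)
      have hxx := hx hat hat' hbv
      subst this hat'
      exact hG.not_triangle hxx he'.2.2 he.2.2
    · exact (f'.2.1 hbv hat' a he.1 hat).1 ((f.2.1 hbv hat a he.1 hat).2 rfl)
  rw [ha]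

/-- A move-closed family of sets of tokens that avoids some vertex has a large boundary. -/
lemma IsTree.le_card_of_moveClosed_of_notMem (hG : G.IsTree) {k d : ℕ} (hk : 1 ≤ k)
    (hd : ∀ A : Finset V, A.card = k → d ≤ (G.tokenMoves A).card) {S : Finset (Finset V)}
    {C : Set (Finset V)} (hC : ∀ A ∈ C, A.card = k) (hne : C.Nonempty) (hcl : G.MoveClosed S C)
    {w : V} (hw : ∀ A ∈ C, w ∉ A) : d ≤ S.card := by
  classical
  -- Take a token `t` as close to `w` as any token of any member of `C`. The next vertex `v` towards
  -- `w` is then never occupied in `C`, so every move to `v` is an exit.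
  obtain ⟨A, hA, t, ht, v, htv, hvC⟩ : ∃ A ∈ C, ∃ t ∈ A, ∃ v, G.Adj t v ∧ ∀ B ∈ C, v ∉ B := by
    have hex : ∃ r, ∃ A ∈ C, ∃ t ∈ A, G.dist t w = r := by
      obtain ⟨A, hA⟩ := hne
      obtain ⟨t, ht⟩ := Finset.card_pos.1 (by have := hC A hA; omega : 0 < A.card)
      exact ⟨_, A, hA, t, ht, rfl⟩
    obtain ⟨A, hA, t, ht, htw⟩ := Nat.find_spec hex
    have hne : t ≠ w := by rintro rfl; exact hw A hA ht
    obtain ⟨p, hp⟩ := hG.connected.exists_walk_length_eq_dist t w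
    cases p with
    | nil => exact absurd rfl hne
    | @cons _ v _ h q =>
      refine ⟨A, hA, t, ht, v, h, fun B hB hvB => ?_⟩
      have h1 := Nat.find_min' hex ⟨B, hB, v, hvB, rfl⟩
      have h2 := G.dist_le q
      rw [Walk.length_cons] at hp
      omega
  have hvA := hvC A hA
  have hexit : ∀ {B : Finset V} {a : V}, B ∈ C → a ∈ B → G.Adj a v →
      insert v (B.erase a) ∈ S := fun {B a} hB ha hav =>
    (hcl B hB _ (.mk ha (hvC B hB) hav)).resolve_left fun h => hvC _ h (by simp)
  -- If a first move, not from `t` and not to `v`, stays in `C`, then moving `t` to `v` exits.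
  have hone : ∀ x, ∀ e ∈ G.tokenMoves A, (e.1 ≠ t ∨ e.2 = v) →
      ∃ B, B ∈ S ∧ ExitOf A t v x e B := by
    rintro x ⟨a, b⟩ he h
    rw [mem_tokenMoves] at he
    obtain ⟨ha, hb, hab⟩ := he
    by_cases hbv : b = v
    · subst hbv
      exact ⟨_, hexit hA ha hab, Or.inl ⟨rfl, rfl⟩⟩
    have hat : a ≠ t := by tauto
    rcases hcl A hA _ (.mk ha hb hab) with h1 | h1
    · exact ⟨_, hexit h1 (by grind) htv, Or.inr (Or.inl ⟨hbv, hat, Or.inr rfl⟩)⟩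
    · exact ⟨_, h1, Or.inr (Or.inl ⟨hbv, hat, Or.inl rfl⟩)⟩
  by_cases hX : ∃ x ∈ A, G.Adj t x
  · obtain ⟨x, hxA, htx⟩ := hX
    refine (hd A (hC A hA)).trans (Finset.card_le_card_of_forall_subsingleton
      (ExitOf A t v x) (fun e he => ?_) ?_)
    · by_cases h : e.1 ≠ t ∨ e.2 = v
      · exact hone x e he h
      push Not at h
      obtain ⟨a, b⟩ := e
      obtain ⟨rfl, hbv⟩ : a = t ∧ b ≠ v := h
      rw [mem_tokenMoves] at he
      obtain ⟨-, hb, hab⟩ := he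
      have hxa : x ≠ a := htx.ne'
      rcases hcl A hA _ (.mk ht hb hab) with h1 | h1
      -- The token has left `t` for `b`; the token at `x` refills `t`, from where it can exit to
      -- `v`.
      · have hmv : G.TokenMove (insert b (A.erase a)) (insert b (A.erase x)) := by
          refine ⟨x, by grind, a, by grind, htx.symm, ?_⟩
          ext y; by_cases y = a <;> by_cases y = b <;> by_cases y = x <;> grind
        rcases hcl _ h1 _ hmv with h2 | h2
        · exact ⟨_, hexit h2 (by grind) htv, Or.inr (Or.inr ⟨hbv, rfl, Or.inr (Or.inr rfl)⟩)⟩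
        · exact ⟨_, h2, Or.inr (Or.inr ⟨hbv, rfl, Or.inr (Or.inl rfl)⟩)⟩
      · exact ⟨_, h1, Or.inr (Or.inr ⟨hbv, rfl, Or.inl rfl⟩)⟩
    · rintro B - e ⟨he, h⟩ e' ⟨he', h'⟩
      exact ExitOf.eq hG ht hvA he he' (fun _ _ _ => htx) (fun _ _ _ => htx) h h'
  · push Not at hX
    obtain ⟨A', hA', hle⟩ := hG.exists_card_tokenMoves_le ht hvA hX
    refine (hd A' (hA'.trans (hC A hA))).trans (hle.trans ?_)
    -- Moves from `t` away from `v` may have no exit. The move `(t, v)` supplies the extra one in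
    -- the bound.
    rw [← Finset.card_insert_of_notMem (a := (t, v)) (by simp)]
    have hmem : ∀ e ∈ insert (t, v) ((G.tokenMoves A).filter fun e => e.1 ≠ t),
        e ∈ G.tokenMoves A ∧ (e.1 ≠ t ∨ e.2 = v) := by
      intro e he
      rw [Finset.mem_insert, Finset.mem_filter] at he
      rcases he with rfl | he
      · exact ⟨mem_tokenMoves.2 ⟨ht, hvA, htv⟩, Or.inr rfl⟩
      · exact ⟨he.1, Or.inl he.2⟩
    -- The parameter `x := t` is a dummy: no remaining move goes from `t` to a vertex other than
    -- `v`.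
    refine Finset.card_le_card_of_forall_subsingleton (ExitOf A t v t)
      (fun e he => hone t e (hmem e he).1 (hmem e he).2) ?_
    rintro B - e ⟨he, h⟩ e' ⟨he', h'⟩
    obtain ⟨he1, he2⟩ := hmem e he
    obtain ⟨he1', he2'⟩ := hmem e' he'
    exact ExitOf.eq hG ht hvA he1 he1' (by tauto) (by tauto) h h'

/-- A move-closed family of sets of tokens that all contain some vertex has a large boundary. -/
lemma IsTree.le_card_of_moveClosed_of_mem (hG : G.IsTree) {k d : ℕ} (hk : k < Fintype.card V)
    (hd : ∀ A : Finset V, A.card = k → d ≤ (G.tokenMoves A).card) {S : Finset (Finset V)}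
    {C : Set (Finset V)} (hC : ∀ A ∈ C, A.card = k) (hne : C.Nonempty) (hcl : G.MoveClosed S C)
    {w : V} (hw : ∀ A ∈ C, w ∈ A) : d ≤ S.card := by
  -- Complementation exchanges tokens with free vertices and preserves moves.
  have := hG.le_card_of_moveClosed_of_notMem (k := Fintype.card V - k) (d := d)
    (S := S.map ⟨compl, compl_injective⟩) (C := compl ⁻¹' C) (w := w) (by omega)
    (fun A hA => by
      rw [← tokenMoves_compl_card]
      exact hd _ (by rw [Finset.card_compl, hA]; omega))
    (fun A hA => by
      have h1 := hC _ hA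
      rw [Finset.card_compl] at h1
      have := Finset.card_le_univ A
      omega)
    (by obtain ⟨A, hA⟩ := hne; exact ⟨Aᶜ, by simpa⟩)
    (fun A hA B hAB => by
      rcases hcl _ hA _ hAB.compl with h | h
      · exact Or.inl h
      · exact Or.inr (Finset.mem_map.2 ⟨_, h, by simp⟩))
    (fun A hA => by simpa using hw _ hA)
  simpa using this

end TokenMoves


/-! ### Deleting a leaf, and the induction on the tree. -/

section TreeInduction

variable {V W : Type*} [DecidableEq V] [DecidableEq W] {G : SimpleGraph V}

lemma TokenMove.map {f : W ↪ V} {A B : Finset W} (h : (G.comap f).TokenMove A B) :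
    G.TokenMove (A.map f) (B.map f) := by
  obtain ⟨a, ha, b, hb, hab, rfl⟩ := h
  exact ⟨f a, by simpa, f b, by simpa, hab, by rw [Finset.map_insert, Finset.map_erase]⟩

lemma TokenMove.insert_map {f : W ↪ V} {l : V} (hl : l ∉ Set.range f) {A B : Finset W}
    (h : (G.comap f).TokenMove A B) :
    G.TokenMove (insert l (A.map f)) (insert l (B.map f)) := by
  have hne : ∀ x, f x ≠ l := fun x hx => hl ⟨x, hx⟩
  obtain ⟨a, ha, b, hb, hab, rfl⟩ := h
  refine ⟨f a, by simp [ha], f b, by simp [hb, hne], hab, ?_⟩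
  rw [Finset.map_insert, Finset.map_erase, Finset.erase_insert_of_ne (hne a).symm,
    Finset.insert_comm]

variable [Fintype V] [Fintype W]

/-- Deleting a leaf costs at most one token move. -/
lemma card_tokenMoves_map_le {f : W ↪ V} {l : V} (hl : ∀ y, y ≠ l → y ∈ Set.range f)
    (hl1 : ∀ a b, G.Adj a l → G.Adj b l → a = b) {A : Finset W} (hlA : l ∉ Set.range f) :
    (G.tokenMoves (A.map f)).card ≤ ((G.comap f).tokenMoves A).card + 1 := by
  have hsplit := Finset.card_filter_add_card_filter_not (s := G.tokenMoves (A.map f))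
    (fun e => e.2 = l)
  have h1 : ((G.tokenMoves (A.map f)).filter fun e => e.2 = l).card ≤ 1 := by
    rw [Finset.card_le_one]
    rintro ⟨a, b⟩ h ⟨a', b'⟩ h'
    simp only [Finset.mem_filter, mem_tokenMoves] at h h'
    obtain ⟨⟨-, -, hab⟩, rfl⟩ := h
    obtain ⟨⟨-, -, hab'⟩, rfl⟩ := h'
    rw [hl1 _ _ hab hab']
  have h2 : ((G.tokenMoves (A.map f)).filter fun e => ¬ e.2 = l).card ≤
      ((G.comap f).tokenMoves A).card := by
    rw [← Finset.card_map (f.prodMap f)]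
    apply Finset.card_le_card
    rintro ⟨a, b⟩ h
    simp only [Finset.mem_filter, mem_tokenMoves] at h
    obtain ⟨⟨ha, hb, hab⟩, hbl⟩ := h
    obtain ⟨a, ha', rfl⟩ := Finset.mem_map.1 ha
    obtain ⟨b, rfl⟩ := hl b hbl
    exact Finset.mem_map.2 ⟨(a, b), mem_tokenMoves.2 ⟨ha', fun h => hb (Finset.mem_map_of_mem f h),
      hab⟩, rfl⟩
  omega

lemma Connected.one_le_card_tokenMoves (hG : G.Connected) {A : Finset V} (h0 : 0 < A.card)
    (h1 : A.card < Fintype.card V) : 1 ≤ (G.tokenMoves A).card := by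
  obtain ⟨u, hu⟩ := Finset.card_pos.1 h0
  obtain ⟨v, hv⟩ : ∃ v, v ∉ A := by
    by_contra! h
    rw [Finset.eq_univ_iff_forall.2 h, Finset.card_univ] at h1
    exact h1.false
  obtain ⟨a, ha, b, hb, hab⟩ := hG.preconnected.exists_adj_mem_notMem (X := (A : Set V)) hu hv
  exact Finset.card_pos.2 ⟨(a, b), mem_tokenMoves.2 ⟨ha, hb, hab⟩⟩

end TreeInduction

/-- In a tree in which every set of `k` tokens has at least `d` moves, any two nonempty families of
`k`-sets that can only be left through `S`, where `S` has fewer than `d` members, intersect. -/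
lemma IsTree.inter_nonempty_of_moveClosed {V : Type*} [Fintype V] [DecidableEq V]
    {G : SimpleGraph V} (hG : G.IsTree) {k d : ℕ}
    (hd : ∀ A : Finset V, A.card = k → d ≤ (G.tokenMoves A).card) {S : Finset (Finset V)}
    (hS : S.card < d ∨ S = ∅) {C D : Set (Finset V)} (hC : ∀ A ∈ C, A.card = k)
    (hD : ∀ A ∈ D, A.card = k) (hCne : C.Nonempty) (hDne : D.Nonempty)
    (hCcl : G.MoveClosed S C) (hDcl : G.MoveClosed S D) : (C ∩ D).Nonempty := by
  classical
  induction hn : Fintype.card V generalizing V k d with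
  | zero =>
    obtain ⟨v⟩ := hG.connected.nonempty
    exact absurd hn (Fintype.card_pos_iff.2 ⟨v⟩).ne'
  | succ n ih =>
    obtain ⟨A, hA⟩ := hCne
    obtain ⟨B, hB⟩ := hDne
    by_cases hk0 : k = 0
    · obtain rfl : A = B := by
        rw [Finset.card_eq_zero.1 ((hC A hA).trans hk0), Finset.card_eq_zero.1 ((hD B hB).trans hk0)]
      exact ⟨A, hA, hB⟩
    by_cases hkn : Fintype.card V ≤ k
    · have huniv : ∀ A : Finset V, A.card = k → A = Finset.univ := fun A h =>
        Finset.eq_univ_of_card A (le_antisymm (Finset.card_le_univ A) (h ▸ hkn))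
      obtain rfl : A = B := by rw [huniv A (hC A hA), huniv B (hD B hB)]
      exact ⟨A, hA, hB⟩
    push Not at hkn
    -- For `S = ∅` the given `d` may be `0`; since `0 < k < |V|`, connectivity allows `d = 1`.
    obtain ⟨d, hd, hS⟩ : ∃ d, (∀ A : Finset V, A.card = k → d ≤ (G.tokenMoves A).card) ∧
        S.card < d := by
      rcases hS with hS | rfl
      · exact ⟨d, hd, hS⟩
      · exact ⟨1, fun A hA => hG.connected.one_le_card_tokenMoves (by omega) (by omega), by simp⟩
    have : Nontrivial V := Fintype.one_lt_card_iff_nontrivial.1 (by omega)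
    obtain ⟨l, hl⟩ := hG.exists_vert_degree_one_of_nontrivial
    set f : ({l}ᶜ : Set V) ↪ V := Function.Embedding.subtype _ with hf
    have hlr : l ∉ Set.range f := by simp [hf]
    have hlr' : ∀ y, y ≠ l → y ∈ Set.range f := fun y hy => by simpa [hf] using hy
    have hG' : (G.comap f).IsTree :=
      ⟨hG.connected.induce_compl_singleton_of_degree_eq_one hl, hG.isAcyclic.induce _⟩
    have hcard : Fintype.card ({l}ᶜ : Set V) = n := by
      rw [Fintype.card_compl_set, hn]; simp
    have hmapl : ∀ A : Finset ({l}ᶜ : Set V), l ∉ A.map f := fun A h =>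
      hlr (by obtain ⟨x, -, hx⟩ := Finset.mem_map.1 h; exact ⟨x, hx⟩)
    have hlift : ∀ A : Finset V, l ∉ A → ∃ A' : Finset ({l}ᶜ : Set V), A'.map f = A := by
      intro A hA
      refine ⟨Finset.univ.filter fun x => f x ∈ A, ?_⟩
      ext y
      simp only [Finset.mem_map, Finset.mem_filter, Finset.mem_univ, true_and]
      constructor
      · rintro ⟨x, hx, rfl⟩; exact hx
      · intro hy
        obtain ⟨x, rfl⟩ := hlr' y (by rintro rfl; exact hA hy)
        exact ⟨x, hy, rfl⟩
    set S₀ : Finset (Finset ({l}ᶜ : Set V)) := Finset.univ.filter fun A => A.map f ∈ S with hS₀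
    have hS₀map : (S₀.map ⟨_, Finset.map_injective f⟩) ⊆ S := by
      intro A hA
      obtain ⟨A', hA', rfl⟩ := Finset.mem_map.1 hA
      exact (Finset.mem_filter.1 hA').2
    by_cases hlt : S₀.card < d - 1
    -- A family missing this slice would consist of sets containing `l`, hence have at least `d`
    -- exits.
    · have hwith : ∀ C : Set (Finset V), (∀ A ∈ C, A.card = k) → C.Nonempty → G.MoveClosed S C →
          {A : Finset ({l}ᶜ : Set V) | A.map f ∈ C}.Nonempty := by
        intro C hC hne hcl
        by_contra hemp
        refine absurd (hG.le_card_of_moveClosed_of_mem (w := l) hkn hd hC hne hcl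
          fun A hA => ?_) (not_le.2 hS)
        by_contra hlA
        obtain ⟨A', rfl⟩ := hlift A hlA
        exact hemp ⟨A', hA⟩
      have hcl : ∀ C : Set (Finset V), G.MoveClosed S C →
          (G.comap f).MoveClosed S₀ {A | A.map f ∈ C} := by
        intro C hcl A hA B hAB
        exact (hcl _ hA _ hAB.map).imp id fun h => by simpa [hS₀] using h
      obtain ⟨X, hX⟩ := ih hG' (k := k) (d := d - 1) (fun A hA => by
          have h1 := hd (A.map f) (by simpa)
          have h2 := card_tokenMoves_map_le hlr' (fun a b ha hb => by
            obtain ⟨w, -, hw⟩ := degree_eq_one_iff_existsUnique_adj.1 hl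
            rw [hw a ha.symm, hw b hb.symm]) (A := A) hlr
          omega)
        (Or.inl hlt) (fun A hA => by simpa using hC _ hA) (fun A hA => by simpa using hD _ hA)
        (hwith C hC ⟨A, hA⟩ hCcl) (hwith D hD ⟨B, hB⟩ hDcl) (hcl C hCcl) (hcl D hDcl) hcard
      exact ⟨_, hX⟩
    -- Now `S₀` has at least `d - 1` members and `S` at most that many, so no member of `S` contains
    -- `l`.
    · have hS₁ : ∀ A : Finset ({l}ᶜ : Set V), insert l (A.map f) ∉ S := by
        intro A hAS
        have hnot : insert l (A.map f) ∉ S₀.map ⟨_, Finset.map_injective f⟩ := by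
          intro h
          obtain ⟨A', -, hA'⟩ := Finset.mem_map.1 h
          exact hmapl A' (by
            rw [show A'.map f = _ from hA']; exact Finset.mem_insert_self _ _)
        have h1 := Finset.card_lt_card ((Finset.ssubset_iff_of_subset hS₀map).2 ⟨_, hAS, hnot⟩)
        rw [Finset.card_map] at h1
        omega
      have hwith : ∀ C : Set (Finset V), (∀ A ∈ C, A.card = k) → C.Nonempty → G.MoveClosed S C →
          {A : Finset ({l}ᶜ : Set V) | insert l (A.map f) ∈ C}.Nonempty := by
        intro C hC hne hcl
        by_contra hemp
        refine absurd (hG.le_card_of_moveClosed_of_notMem (w := l) (by omega) hd hC hne hcl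
          fun A hA hlA => ?_) (not_le.2 hS)
        obtain ⟨A', hA'⟩ := hlift (A.erase l) (by simp)
        exact hemp ⟨A', by rwa [Set.mem_ofPred_eq, hA', Finset.insert_erase hlA]⟩
      have hcl : ∀ C : Set (Finset V), G.MoveClosed S C →
          (G.comap f).MoveClosed ∅ {A | insert l (A.map f) ∈ C} := by
        intro C hcl A hA B hAB
        exact Or.inl ((hcl _ hA _ (hAB.insert_map hlr)).resolve_right (hS₁ B))
      have hcard' : ∀ A : Finset ({l}ᶜ : Set V), (insert l (A.map f)).card = k →
          A.card = k - 1 := by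
        intro A hA
        rw [Finset.card_insert_of_notMem (hmapl A), Finset.card_map] at hA
        omega
      -- With no obstruction left the bound is irrelevant, which is what the alternative `S = ∅` in
      -- the hypothesis serves.
      obtain ⟨X, hX⟩ := ih hG' (k := k - 1) (d := 0) (fun _ _ => Nat.zero_le _)
        (Or.inr rfl) (fun A hA => hcard' A (hC _ hA)) (fun A hA => hcard' A (hD _ hA))
        (hwith C hC ⟨A, hA⟩ hCcl) (hwith D hD ⟨B, hB⟩ hDcl) (hcl C hCcl) (hcl D hDcl) hcard
      exact ⟨_, hX⟩


/-! ### Whitney's inequality and the reduction to vertex-connectivity. -/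

section Whitney

variable {V : Type*} [Fintype V] {G : SimpleGraph V}

/-- Whitney's inequality `κ ≤ λ`. -/
lemma IsVertexConnected.isEdgeConnected {t : ℕ} (h : G.IsVertexConnected t) :
    G.IsEdgeConnected t := by
  classical
  intro u v s hs
  by_contra huv
  have hfin : s.Finite := Set.encard_lt_top_iff.1 (hs.trans (ENat.natCast_lt_top t))
  set X : Set V := {x | (G.deleteEdges s).Reachable u x} with hX
  have hcross : ∀ a ∈ X, ∀ b ∉ X, G.Adj a b → s(a, b) ∈ s := by
    intro a ha b hb hab
    by_contra hs'
    exact hb (ha.trans (Adj.reachable (by rw [deleteEdges_adj]; exact ⟨hab, hs'⟩)))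
  set F : Finset (Sym2 V) := hfin.toFinset
  have hF : F.card < t := by
    rw [hfin.encard_eq_coe_toFinset_card] at hs
    exact_mod_cast hs
  by_cases hxy : ∃ x ∈ X, ∃ y ∉ X, ¬ G.Adj x y
  · obtain ⟨x, hx, y, hy, hxy⟩ := hxy
    -- As `x` and `y` are not adjacent, each cut edge has an end other than both. Deleting these
    -- ends separates `x` from `y`.
    have hend : ∀ e : Sym2 V, ∃ o : Finset V, o.card ≤ 1 ∧ x ∉ o ∧ y ∉ o ∧
        ∀ a ∈ X, ∀ b ∉ X, G.Adj a b → e = s(a, b) → a ∈ o ∨ b ∈ o := by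
      intro e
      by_cases he : ∃ a ∈ X, ∃ b ∉ X, G.Adj a b ∧ e = s(a, b)
      · obtain ⟨a, ha, b, hb, hab, rfl⟩ := he
        by_cases hax : a = x
        · subst hax
          refine ⟨{b}, by simp, ?_, ?_, ?_⟩
          · rw [Finset.mem_singleton]; rintro rfl; exact hb ha
          · rw [Finset.mem_singleton]; rintro rfl; exact hxy hab
          · intro a' _ b' _ _ h
            have : b ∈ s(a', b') := h ▸ Sym2.mem_mk_right a b
            simpa [eq_comm] using this
        · refine ⟨{a}, by simp, ?_, ?_, ?_⟩
          · simpa [eq_comm] using hax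
          · rw [Finset.mem_singleton]; rintro rfl; exact hy ha
          · intro a' _ b' _ _ h
            have : a ∈ s(a', b') := h ▸ Sym2.mem_mk_left a b
            simpa [eq_comm] using this
      · exact ⟨∅, by simp, by simp, by simp, fun a ha b hb hab h =>
          (he ⟨a, ha, b, hb, hab, h⟩).elim⟩
    choose o ho hox hoy hcov using hend
    have hcon := h.2 (F.biUnion o)
      ((Finset.card_biUnion_le_card_mul _ _ 1 fun e _ => ho e).trans_lt (by simpa using hF))
    obtain ⟨a, ha, b, hb, hab⟩ := hcon.preconnected.exists_adj_mem_notMem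
      (X := {w | w.1 ∈ X}) (u := ⟨x, by simpa using fun e _ => hox e⟩)
      (v := ⟨y, by simpa using fun e _ => hoy e⟩) hx hy
    have hmem : s(a.1, b.1) ∈ F := by simpa [F] using hcross a ha b hb hab
    rcases hcov _ a ha b hb hab rfl with h1 | h1
    · exact a.2 (Finset.mem_biUnion.2 ⟨_, hmem, h1⟩)
    · exact b.2 (Finset.mem_biUnion.2 ⟨_, hmem, h1⟩)
  · push Not at hxy
    have hu : u ∈ X := Reachable.refl u
    -- All pairs across the cut are adjacent, so the edges from `X` to `v` and from `u` to the other
    -- side already number `|V| - 1 ≥ t`.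
    have hle : (Finset.univ.erase u).card ≤ F.card := by
      refine Finset.card_le_card_of_injOn (fun w => if w ∈ X then s(w, v) else s(u, w)) ?_ ?_
      · intro w _
        by_cases hw : w ∈ X
        · simpa [F, hw] using hcross w hw v huv (hxy w hw v huv)
        · simpa [F, hw] using hcross u hu w hw (hxy u hu w hw)
      · intro w hw w' hw' heq
        simp only [Finset.coe_erase, Finset.coe_univ, Set.mem_sdiff, Set.mem_univ,
          Set.mem_singleton_iff, true_and] at hw hw'
        have hvX : v ∉ X := huv
        by_cases h1 : w ∈ X <;> by_cases h2 : w' ∈ X <;>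
          simp only [h1, h2, if_true, if_false, Sym2.eq_iff] at heq <;> grind
    rw [Finset.card_erase_of_mem (Finset.mem_univ u), Finset.card_univ] at hle
    have := h.1
    omega

/-- A graph that is as vertex-connected as its minimum degree allows has `κ = λ = δ`. -/
lemma IsVertexConnected.connectivity_eq_minDegree [Nontrivial V] [DecidableRel G.Adj]
    (h : G.IsVertexConnected G.minDegree) :
    G.vertexConnectivity = G.minDegree ∧ G.edgeConnectivity = G.minDegree := by
  have hle : ∀ t, G.IsEdgeConnected t → t ≤ G.minDegree := fun t ht =>
    G.le_minDegree_of_forall_le_degree t fun _ => ht.le_degree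
  have h1 : IsGreatest {t | G.IsVertexConnected t} G.minDegree :=
    ⟨h, fun t ht => hle t (IsVertexConnected.isEdgeConnected ht)⟩
  have h2 : IsGreatest {t | G.IsEdgeConnected t} G.minDegree :=
    ⟨h.isEdgeConnected, fun t ht => hle t ht⟩
  exact ⟨h1.csSup_eq, h2.csSup_eq⟩

end Whitney
-- From token moves to the token graph.
section TokenGraph

variable {V : Type*} [DecidableEq V] {G : SimpleGraph V} {k : ℕ}

/-- Equal cardinalities force the two elements of the symmetric difference to lie one in each set.
-/
lemma tokenGraph_adj_iff {A B : {A : Finset V // A.card = k}} :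
    (G.tokenGraph k).Adj A B ↔ G.TokenMove A.1 B.1 := by
  obtain ⟨A, hA⟩ := A
  obtain ⟨B, hB⟩ := B
  change (∃ a b, G.Adj a b ∧ symmDiff A B = {a, b}) ↔ G.TokenMove A B
  constructor
  · rintro ⟨a, b, hab, h⟩
    have hc : (A \ B).card = (B \ A).card := Finset.card_sdiff_comm (hA.trans hB.symm)
    have hmem : ∀ y, (y ∈ A ∧ y ∉ B ∨ y ∈ B ∧ y ∉ A) ↔ y = a ∨ y = b := fun y => by
      simpa [Finset.mem_symmDiff] using Finset.ext_iff.1 h y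
    have hne := hab.ne
    have key : ∀ a b, G.Adj a b → (∀ y, (y ∈ A ∧ y ∉ B ∨ y ∈ B ∧ y ∉ A) ↔ y = a ∨ y = b) →
        a ∈ A → G.TokenMove A B := by
      intro a b hab hmem ha
      have hne := hab.ne
      have haB : a ∉ B := by have := (hmem a).2 (Or.inl rfl); tauto
      have hbA : b ∉ A := by
        intro hb
        have hbB : b ∉ B := by have := (hmem b).2 (Or.inr rfl); tauto
        have h0 : B \ A = ∅ := by
          rw [Finset.eq_empty_iff_forall_notMem]
          intro y hy
          rw [Finset.mem_sdiff] at hy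
          rcases (hmem y).1 (Or.inr hy) with rfl | rfl
          · exact hy.2 ha
          · exact hy.2 hb
        rw [h0, Finset.card_empty, Finset.card_eq_zero] at hc
        exact haB (Finset.sdiff_eq_empty_iff_subset.1 hc ha)
      refine ⟨a, ha, b, hbA, hab, ?_⟩
      ext y
      have := hmem y
      by_cases y = a <;> by_cases y = b <;> grind
    by_cases ha : a ∈ A
    · exact key a b hab hmem ha
    by_cases hb : b ∈ A
    · exact key b a hab.symm (fun y => by rw [hmem y, or_comm]) hb
    exfalso
    have h0 : A \ B = ∅ := by
      rw [Finset.eq_empty_iff_forall_notMem]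
      intro y hy
      rw [Finset.mem_sdiff] at hy
      rcases (hmem y).1 (Or.inl hy) with rfl | rfl
      · exact ha hy.1
      · exact hb hy.1
    rw [h0, Finset.card_empty, eq_comm, Finset.card_eq_zero] at hc
    have := (hmem a).2 (Or.inl rfl)
    exact ha (Finset.sdiff_eq_empty_iff_subset.1 hc (by tauto))
  · rintro ⟨a, ha, b, hb, hab, rfl⟩
    refine ⟨a, b, hab, ?_⟩
    have hne := hab.ne
    ext y
    by_cases y = a <;> by_cases y = b <;> grind [Finset.mem_symmDiff]

lemma TokenMove.card_eq {A B : Finset V} (h : G.TokenMove A B) : B.card = A.card := by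
  obtain ⟨a, ha, b, hb, -, rfl⟩ := h
  exact card_insert_erase ha hb

variable [Fintype V]

lemma degree_tokenGraph_le (A : {A : Finset V // A.card = k})
    [Fintype ((G.tokenGraph k).neighborSet A)] :
    (G.tokenGraph k).degree A ≤ (G.tokenMoves A.1).card := by
  rw [← card_neighborFinset_eq_degree]
  refine Finset.card_le_card_of_surjOn
    (fun e => if h : (insert e.2 (A.1.erase e.1)).card = k then ⟨_, h⟩ else A) ?_
  intro B hB
  rw [Finset.mem_coe, mem_neighborFinset, tokenGraph_adj_iff] at hB
  obtain ⟨a, ha, b, hb, hab, h⟩ := hB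
  refine ⟨(a, b), mem_tokenMoves.2 ⟨ha, hb, hab⟩, ?_⟩
  have := B.2
  rw [h] at this
  simp only [this, dite_true]
  exact Subtype.ext h.symm

lemma IsTree.isVertexConnected_tokenGraph (hG : G.IsTree)
    [Nonempty {A : Finset V // A.card = k}] [DecidableRel (G.tokenGraph k).Adj] :
    (G.tokenGraph k).IsVertexConnected (G.tokenGraph k).minDegree := by
  classical
  refine ⟨minDegree_lt_card _, fun S hS => ?_⟩
  rw [connected_iff]
  constructor
  · intro A B
    -- The component of `A` after deleting `S`, seen as a family of plain finsets.
    let reach (A : {A // A ∉ S}) : Set (Finset V) :=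
      {X | ∃ X' : {A // A ∉ S}, X'.1.1 = X ∧
        ((G.tokenGraph k).induce {A | A ∉ S}).Reachable A X'}
    have hcl : ∀ A, G.MoveClosed (S.map (Function.Embedding.subtype _)) (reach A) := by
      rintro A _ ⟨X, rfl, hX⟩ Y hXY
      have hY : Y.card = k := hXY.card_eq.trans X.1.2
      by_cases hYS : (⟨Y, hY⟩ : {A : Finset V // A.card = k}) ∈ S
      · exact Or.inr (Finset.mem_map.2 ⟨_, hYS, rfl⟩)
      · refine Or.inl ⟨⟨⟨Y, hY⟩, hYS⟩, rfl, hX.trans (Adj.reachable ?_)⟩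
        exact tokenGraph_adj_iff.2 hXY
    have hcard : ∀ A, ∀ X ∈ reach A, X.card = k := by
      rintro A _ ⟨X, rfl, -⟩
      exact X.1.2
    obtain ⟨X, ⟨X₁, h1, hA⟩, ⟨X₂, h2, hB⟩⟩ := hG.inter_nonempty_of_moveClosed
      (fun A hA => ((G.tokenGraph k).minDegree_le_degree ⟨A, hA⟩).trans (degree_tokenGraph_le _))
      (Or.inl (by simpa using hS)) (hcard A) (hcard B) ⟨_, A, rfl, .refl _⟩ ⟨_, B, rfl, .refl _⟩
      (hcl A) (hcl B)
    obtain rfl : X₁ = X₂ := Subtype.ext (Subtype.ext (h1.trans h2.symm))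
    exact hA.trans hB.symm
  · have : S.card < Fintype.card {A : Finset V // A.card = k} := hS.trans (minDegree_lt_card _)
    obtain ⟨A, hA⟩ : ∃ A, A ∉ S := by
      by_contra! h
      rw [Finset.eq_univ_iff_forall.2 h, Finset.card_univ] at this
      exact this.false
    exact ⟨⟨A, hA⟩⟩

end TokenGraph

end SimpleGraph

theorem theorem1 {V : Type*} [Fintype V] [DecidableEq V] (G : SimpleGraph V) (hG : G.IsTree)
    (n : ℕ) (hn : Fintype.card V = n) (k : ℕ) (hk1 : 1 ≤ k) (hkn : k ≤ n - 1)
    [DecidableRel (G.tokenGraph k).Adj] :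
    (G.tokenGraph k).vertexConnectivity = (G.tokenGraph k).edgeConnectivity ∧
      (G.tokenGraph k).edgeConnectivity = (G.tokenGraph k).minDegree := by
  have : Nontrivial {A : Finset V // A.card = k} := by
    rw [← Fintype.one_lt_card_iff_nontrivial, Fintype.card_finset_len, hn]
    obtain ⟨m, rfl⟩ : ∃ m, n = m + 1 := ⟨n - 1, by omega⟩
    obtain ⟨j, rfl⟩ : ∃ j, k = j + 1 := ⟨k - 1, by omega⟩
    -- Both summands are positive, so the token graph has at least two vertices, as the bound `λ ≤
    -- δ` needs.
    rw [Nat.choose_succ_succ]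
    have := Nat.choose_pos (show j ≤ m by omega)
    have := Nat.choose_pos (show j.succ ≤ m by omega)
    omega
  obtain ⟨h1, h2⟩ := hG.isVertexConnected_tokenGraph (k := k) |>.connectivity_eq_minDegree
  exact ⟨h1.trans h2.symm, h2⟩
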